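/- Let $n\ge 3$ and $p>\frac{n+2}{n-2}$. Let $w\in C^2(\mathbb{R}^n)$ be a bounded real-valued function satisfying \[\Delta w-\frac{y}{2}\cdot\nabla w-\frac{1}{p-1}w+|w|^{p-1}w=0\quad\text{in }\mathbb{R}^n .\] For $x_0\in\mathbb{R}^n$ and $t_0<0$ put \[\begin{aligned}F_{x_0,t_0}(w)={}&\frac12(-t_0)^{\frac{p+1}{p-1}}\int_{\mathbb{R}^n}|\nabla w|^2\,G(y-x_0,t_0)\,dy-\frac{1}{p+1}(-t_0)^{\frac{p+1}{p-1}}\int_{\mathbb{R}^n}|w|^{p+1}\,G(y-x_0,t_0)\,dy\\&+\frac{1}{2(p-1)}(-t_0)^{\frac{2}{p-1}}\int_{\mathbb{R}^n}w^2\,G(y-x_0,t_0)\,dy,\end{aligned}\] where $G(y,t)=(-4\pi t)^{-n/2}e^{|y|^2/(4t)}$ for $t<0$. Let \[\lambda(w)=\sup_{x_0\in\mathbb{R}^n,\;t_0<0}F_{x_0,t_0}(w)\in[-\infty,+\infty]\] be the entropy of $w$, and let \[E(w)=\frac12\int_{\mathbb{R}^n}|\nabla w|^2\rho\,dy+\frac{1}{2(p-1)}\int_{\mathbb{R}^n}w^2\rho\,dy-\frac{1}{p+1}\int_{\mathbb{R}^n}|w|^{p+1}\rho\,dy,\qquad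 \rho(y)=(4\pi)^{-n/2}e^{-|y|^2/4},\] be its weighted energy. Then all the integrals in $F_{x_0,t_0}(w)$ converge for every $x_0\in\mathbb{R}^n$ and $t_0<0$, the map $(x_0,t_0)\mapsto F_{x_0,t_0}(w)$ on $\mathbb{R}^n\times(-\infty,0)$ attains its supremum at $(0,-1)$, that is, $F_{x_0,t_0}(w)\le F_{0,-1}(w)=\lambda(w)$ for all $x_0\in\mathbb{R}^n$ and $t_0<0$, and \[\lambda(w)=E(w).\] -/

import Mathlib

open scoped InnerProductSpace

noncomputable section

namespace SupercriticalFujita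

variable {n : ℕ}

/-- The equation `Δw - (y/2)·∇w - w/(p-1) + |w|^{p-1} w = 0` on `ℝⁿ`, in the classical sense:
`w` is twice continuously differentiable and the equation holds at every point. -/
def IsSelfSimilarSolution (p : ℝ) (w : EuclideanSpace ℝ (Fin n) → ℝ) : Prop :=
  ContDiff ℝ 2 w ∧
    ∀ y : EuclideanSpace ℝ (Fin n),
      Laplacian.laplacian w y - 1 / 2 * ⟪y, gradient w y⟫_ℝ - 1 / (p - 1) * w y
        + |w y| ^ (p - 1) * w y = 0

/-- The backward heat kernel `G(y,t) = (-4πt)^{-n/2} e^{|y|²/(4t)}`, used for `t < 0`. -/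
def heatKernel (y : EuclideanSpace ℝ (Fin n)) (t : ℝ) : ℝ :=
  (-4 * Real.pi * t) ^ (-(n : ℝ) / 2) * Real.exp (‖y‖ ^ 2 / (4 * t))

/-- The Gaussian weight `ρ(y) = (4π)^{-n/2} e^{-|y|²/4}`. -/
def gaussianWeight (y : EuclideanSpace ℝ (Fin n)) : ℝ :=
  (4 * Real.pi) ^ (-(n : ℝ) / 2) * Real.exp (-‖y‖ ^ 2 / 4)

/-- The functional `F_{x₀,t₀}(w)`, used for `t₀ < 0`. -/
def FFunctional (p : ℝ) (w : EuclideanSpace ℝ (Fin n) → ℝ)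
    (x₀ : EuclideanSpace ℝ (Fin n)) (t₀ : ℝ) : ℝ :=
  1 / 2 * (-t₀) ^ ((p + 1) / (p - 1)) * (∫ y, ‖gradient w y‖ ^ 2 * heatKernel (y - x₀) t₀)
    - 1 / (p + 1) * (-t₀) ^ ((p + 1) / (p - 1)) *
        (∫ y, |w y| ^ (p + 1) * heatKernel (y - x₀) t₀)
    + 1 / (2 * (p - 1)) * (-t₀) ^ (2 / (p - 1)) *
        (∫ y, w y ^ 2 * heatKernel (y - x₀) t₀)

/-- The three integrals in `F_{x₀,t₀}(w)` converge. -/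
def FIntegrable (p : ℝ) (w : EuclideanSpace ℝ (Fin n) → ℝ)
    (x₀ : EuclideanSpace ℝ (Fin n)) (t₀ : ℝ) : Prop :=
  MeasureTheory.Integrable (fun y => ‖gradient w y‖ ^ 2 * heatKernel (y - x₀) t₀) ∧
    MeasureTheory.Integrable (fun y => |w y| ^ (p + 1) * heatKernel (y - x₀) t₀) ∧
    MeasureTheory.Integrable (fun y => w y ^ 2 * heatKernel (y - x₀) t₀)

/-- The entropy `λ(w) = sup {F_{x₀,t₀}(w) : x₀ ∈ ℝⁿ, t₀ < 0}`, an extended real number, since the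
supremum may be infinite for a general `w`. -/
def entropy (p : ℝ) (w : EuclideanSpace ℝ (Fin n) → ℝ) : EReal :=
  ⨆ (x₀ : EuclideanSpace ℝ (Fin n)) (t₀ : ℝ) (_ : t₀ < 0), ((FFunctional p w x₀ t₀ : ℝ) : EReal)

/-- The weighted energy `E(w)`. -/
def weightedEnergy (p : ℝ) (w : EuclideanSpace ℝ (Fin n) → ℝ) : ℝ :=
  1 / 2 * (∫ y, ‖gradient w y‖ ^ 2 * gaussianWeight y)
    + 1 / (2 * (p - 1)) * (∫ y, w y ^ 2 * gaussianWeight y)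
    - 1 / (p + 1) * (∫ y, |w y| ^ (p + 1) * gaussianWeight y)

end SupercriticalFujita

end

/-! Join (0,-1) to (x₀,t₀) by the curve s ↦ (sX, -τ), τ = 1 + T s², 0 ≤ s ≤ 1, with X = x₀ and T =
-t₀ - 1. The functional F does not increase along it (`antitoneOn_FFunctional_curve`), so F is
largest at the start, where it equals E(w).

Put z = y - sX, b = Ts/τ, and let K be the heat kernel centred at the point of the curve. Then ∇K =
-(z/(2τ))K, whereas the drift in the equation is adapted to the weight ρ, with ∇ρ = -(y/2)ρ. The
mismatch is y - z/τ = sU with U = bz + X affine. The function D = U·∇w + (2/(p-1)) b w is the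
infinitesimal change of w under the translation and scaling generated by U. Multiplying the equation
by D and adding the variation of the energy density e along U shows that the divergence of K(D∇w -
eU) is the integrand of τ^{-(p+1)/(p-1)} dF/ds plus (s/2) D²K
(`divergence_curveKernel_smul_energyFlux`). The divergence integrates to zero, hence dF/ds =
-τ^{(p+1)/(p-1)} (s/2) ∫ D²K ≤ 0.

Only w is assumed bounded, so control of ∇w has to come from the equation: a Caccioppoli estimate
(`gaussianIntegrable_gradient_sq`) makes |∇w|² integrable against every Gaussian. Polynomial factors
are then harmless, which justifies the divergence theorem without boundary term and differentiation
under the integral. -/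

open scoped InnerProductSpace

noncomputable section

namespace SupercriticalFujita

variable {n : ℕ}

open MeasureTheory Filter Topology

/-! ### Divergence, cutoffs and the divergence theorem -/

/-- The divergence of a vector field on `ℝⁿ`. -/
def divergence (W : EuclideanSpace ℝ (Fin n) → EuclideanSpace ℝ (Fin n))
    (y : EuclideanSpace ℝ (Fin n)) : ℝ :=
  ∑ i, fderiv ℝ W y (EuclideanSpace.single i 1) i

lemma sum_coord_smul_single (v : EuclideanSpace ℝ (Fin n)) :
    ∑ i, v i • EuclideanSpace.single i (1 : ℝ) = v := by
  have := (EuclideanSpace.basisFun (Fin n) ℝ).sum_repr v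
  simpa using this

lemma sum_apply_single_mul (L : EuclideanSpace ℝ (Fin n) →L[ℝ] ℝ)
    (v : EuclideanSpace ℝ (Fin n)) :
    ∑ i, L (EuclideanSpace.single i 1) * v i = L v := by
  conv_rhs => rw [← sum_coord_smul_single v, map_sum]
  simp [mul_comm]

lemma hasFDerivAt_coord {W : EuclideanSpace ℝ (Fin n) → EuclideanSpace ℝ (Fin n)}
    {W' : EuclideanSpace ℝ (Fin n) →L[ℝ] EuclideanSpace ℝ (Fin n)}
    {y : EuclideanSpace ℝ (Fin n)} (h : HasFDerivAt W W' y) (i : Fin n) :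
    HasFDerivAt (fun y => W y i) ((EuclideanSpace.proj i).comp W') y :=
  (EuclideanSpace.proj (𝕜 := ℝ) i).hasFDerivAt.comp y h

lemma continuous_divergence {W : EuclideanSpace ℝ (Fin n) → EuclideanSpace ℝ (Fin n)}
    (hW : ContDiff ℝ 1 W) : Continuous (divergence W) := by
  unfold divergence
  have := hW.continuous_fderiv one_ne_zero
  fun_prop

lemma divergence_smul {φ : EuclideanSpace ℝ (Fin n) → ℝ}
    {W : EuclideanSpace ℝ (Fin n) → EuclideanSpace ℝ (Fin n)} {y : EuclideanSpace ℝ (Fin n)}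
    (hφ : DifferentiableAt ℝ φ y) (hW : DifferentiableAt ℝ W y) :
    divergence (fun y => φ y • W y) y = φ y * divergence W y + fderiv ℝ φ y (W y) := by
  have h : fderiv ℝ (fun y => φ y • W y) y = φ y • fderiv ℝ W y + (fderiv ℝ φ y).smulRight (W y) :=
    fderiv_fun_smul hφ hW
  rw [divergence, h, divergence, ← sum_apply_single_mul, Finset.mul_sum, ← Finset.sum_add_distrib]
  simp

lemma divergence_add {V W : EuclideanSpace ℝ (Fin n) → EuclideanSpace ℝ (Fin n)}
    {y : EuclideanSpace ℝ (Fin n)}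
    (hV : DifferentiableAt ℝ V y) (hW : DifferentiableAt ℝ W y) :
    divergence (fun y => V y + W y) y = divergence V y + divergence W y := by
  rw [divergence, fderiv_fun_add hV hW, divergence, divergence, ← Finset.sum_add_distrib]
  simp

lemma divergence_affine (b : ℝ) (x v y : EuclideanSpace ℝ (Fin n)) :
    divergence (fun y => b • (y - x) + v) y = n * b := by
  have h : HasFDerivAt (fun y => b • (y - x) + v)
      (b • ContinuousLinearMap.id ℝ (EuclideanSpace ℝ (Fin n))) y :=
    (((hasFDerivAt_id y).sub_const x).const_smul b).add_const v
  rw [divergence, h.fderiv]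
  simp

/-- Integration by parts against a compactly supported function. -/
lemma integral_mul_divergence {η : EuclideanSpace ℝ (Fin n) → ℝ}
    {W : EuclideanSpace ℝ (Fin n) → EuclideanSpace ℝ (Fin n)}
    (hη : ContDiff ℝ 1 η) (hs : HasCompactSupport η) (hW : ContDiff ℝ 1 W) :
    ∫ y, η y * divergence W y = - ∫ y, fderiv ℝ η y (W y) := by
  have hηc := hη.continuous
  have hηd := hη.continuous_fderiv one_ne_zero
  have hWc := hW.continuous
  have hWd := hW.continuous_fderiv one_ne_zero
  have hd (y) : DifferentiableAt ℝ W y := hW.differentiable one_ne_zero y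
  have hf (i : Fin n) (y) : fderiv ℝ (fun y => W y i) y (EuclideanSpace.single i 1)
      = fderiv ℝ W y (EuclideanSpace.single i 1) i := by
    rw [(hasFDerivAt_coord (hd y).hasFDerivAt i).fderiv]; rfl
  have h1 (i : Fin n) : Integrable
      (fun y => η y * fderiv ℝ W y (EuclideanSpace.single i 1) i) :=
    Continuous.integrable_of_hasCompactSupport (by fun_prop) hs.mul_right
  have h2 (i : Fin n) : Integrable
      (fun y => fderiv ℝ η y (EuclideanSpace.single i 1) * W y i) :=
    Continuous.integrable_of_hasCompactSupport (by fun_prop)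
      ((hs.fderiv_apply ℝ (EuclideanSpace.single i 1)).mul_right)
  have h3 (i : Fin n) : Integrable (fun y => η y * W y i) :=
    Continuous.integrable_of_hasCompactSupport (by fun_prop) hs.mul_right
  have key (i : Fin n) := integral_mul_fderiv_eq_neg_fderiv_mul_of_integrable (μ := volume)
    (f := η) (g := fun y => W y i) (v := EuclideanSpace.single i 1) (h2 i)
    (by simpa only [hf] using h1 i) (h3 i)
    (fun y _ => hη.differentiable one_ne_zero y)
    (fun y _ => (hasFDerivAt_coord (hd y).hasFDerivAt i).differentiableAt)
  simp only [hf] at key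
  have e (y) := (sum_apply_single_mul (fderiv ℝ η y) (W y)).symm
  simp only [divergence, Finset.mul_sum, e]
  rw [integral_finsetSum _ fun i _ => h1 i, integral_finsetSum _ fun i _ => h2 i,
    ← Finset.sum_neg_distrib]
  exact Finset.sum_congr rfl fun i _ => key i

/-- A smooth cutoff function, equal to `1` on the ball of radius `k + 1`. -/
def cutoff (k : ℕ) (y : EuclideanSpace ℝ (Fin n)) : ℝ :=
  (⟨1, 2, one_pos, one_lt_two⟩ : ContDiffBump (0 : EuclideanSpace ℝ (Fin n)))
    ((1 / ((k : ℝ) + 1)) • y)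

lemma contDiff_cutoff (k : ℕ) : ContDiff ℝ 1 (cutoff (n := n) k) :=
  (ContDiffBump.contDiff _).comp (contDiff_id.const_smul _)

lemma hasCompactSupport_cutoff (k : ℕ) : HasCompactSupport (cutoff (n := n) k) :=
  (ContDiffBump.hasCompactSupport _).comp_smul (by positivity)

lemma cutoff_nonneg (k : ℕ) (y : EuclideanSpace ℝ (Fin n)) : 0 ≤ cutoff k y :=
  ContDiffBump.nonneg _

lemma cutoff_le_one (k : ℕ) (y : EuclideanSpace ℝ (Fin n)) : cutoff k y ≤ 1 :=
  ContDiffBump.le_one _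

lemma cutoff_eq_one {k : ℕ} {y : EuclideanSpace ℝ (Fin n)} (h : ‖y‖ ≤ k + 1) :
    cutoff k y = 1 := by
  apply ContDiffBump.one_of_mem_closedBall
  rw [mem_closedBall_zero_iff, norm_smul, Real.norm_of_nonneg (by positivity), one_div,
    inv_mul_le_iff₀ (by positivity)]
  simpa using h

lemma tendsto_cutoff (y : EuclideanSpace ℝ (Fin n)) :
    Tendsto (fun k => cutoff k y) atTop (𝓝 1) := by
  obtain ⟨N, hN⟩ := exists_nat_ge ‖y‖
  refine tendsto_const_nhds.congr' ?_
  filter_upwards [eventually_ge_atTop N] with k hk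
  refine (cutoff_eq_one ?_).symm
  have : (N : ℝ) ≤ k := by exact_mod_cast hk
  linarith

/-- All cutoffs are dilations of one bump; C bounds the derivative of that bump and the chain rule
supplies 1/(k+1). -/
lemma exists_norm_fderiv_cutoff_le : ∃ C : ℝ, 0 ≤ C ∧
    ∀ (k : ℕ) (y : EuclideanSpace ℝ (Fin n)), ‖fderiv ℝ (cutoff k) y‖ ≤ C / (k + 1) := by
  set f : ContDiffBump (0 : EuclideanSpace ℝ (Fin n)) := ⟨1, 2, one_pos, one_lt_two⟩ with hf
  obtain ⟨C, hC⟩ := (f.hasCompactSupport.fderiv ℝ).exists_bound_of_continuous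
    (f.contDiff.continuous_fderiv one_ne_zero)
  refine ⟨C, (norm_nonneg _).trans (hC 0), fun k y => ?_⟩
  have : fderiv ℝ (cutoff k) y = (1 / ((k : ℝ) + 1)) • fderiv ℝ f ((1 / ((k : ℝ) + 1)) • y) :=
    fderiv_comp_smul _
  rw [this, norm_smul, Real.norm_of_nonneg (by positivity), div_mul_eq_mul_div, one_mul]
  gcongr
  exact hC _

/-- The divergence theorem on `ℝⁿ` for integrable fields with integrable divergence. -/
theorem integral_divergence_eq_zero
    {W : EuclideanSpace ℝ (Fin n) → EuclideanSpace ℝ (Fin n)}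
    (hW : ContDiff ℝ 1 W) (hWi : Integrable W) (hdiv : Integrable (divergence W)) :
    ∫ y, divergence W y = 0 := by
  obtain ⟨C, hC0, hC⟩ := exists_norm_fderiv_cutoff_le (n := n)
  have h1 : Tendsto (fun k => ∫ y, cutoff k y * divergence W y) atTop
      (𝓝 (∫ y, divergence W y)) := by
    refine tendsto_integral_of_dominated_convergence (fun y => ‖divergence W y‖) (fun k => ?_)
      hdiv.norm (fun k => .of_forall fun y => ?_) (.of_forall fun y => ?_)
    · exact ((contDiff_cutoff k).continuous.mul (continuous_divergence hW)).aestronglyMeasurable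
    · rw [norm_mul, Real.norm_of_nonneg (cutoff_nonneg k y)]
      exact mul_le_of_le_one_left (norm_nonneg _) (cutoff_le_one k y)
    · simpa using (tendsto_cutoff y).mul_const (divergence W y)
  -- With the derivative moved onto the cutoff, the integral is at most C/(k+1) times the L¹ norm of
  -- W.
  have h2 : Tendsto (fun k => ∫ y, cutoff k y * divergence W y) atTop (𝓝 0) := by
    refine squeeze_zero_norm (a := fun k : ℕ => C * (∫ y, ‖W y‖) * (1 / ((k : ℝ) + 1))) (fun k => ?_)
      (by simpa using tendsto_one_div_add_atTop_nhds_zero_nat.const_mul (C * ∫ y, ‖W y‖))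
    rw [integral_mul_divergence (contDiff_cutoff k) (hasCompactSupport_cutoff k) hW, norm_neg]
    calc _ ≤ ∫ y, C / (k + 1) * ‖W y‖ :=
          norm_integral_le_of_norm_le (hWi.norm.const_mul _) (.of_forall fun y =>
            (ContinuousLinearMap.le_opNorm _ _).trans (by gcongr; exact hC k y))
      _ = _ := by rw [integral_const_mul]; ring
  exact tendsto_nhds_unique h1 h2

/-! ### Gradient, Hessian and Laplacian -/

section Gradient

variable {w : EuclideanSpace ℝ (Fin n) → ℝ}

lemma fderiv_apply_eq_inner_gradient (y v : EuclideanSpace ℝ (Fin n)) :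
    fderiv ℝ w y v = ⟪gradient w y, v⟫_ℝ := by
  rw [← toDual_gradient]; rfl

lemma contDiff_gradient (hw : ContDiff ℝ 2 w) : ContDiff ℝ 1 (gradient w) :=
  (InnerProductSpace.toDual ℝ (EuclideanSpace ℝ (Fin n))).symm.contDiff.comp
    (hw.fderiv_right (m := 1) (by norm_num))

lemma inner_fderiv_gradient (hw : ContDiff ℝ 2 w) (y v u : EuclideanSpace ℝ (Fin n)) :
    ⟪fderiv ℝ (gradient w) y v, u⟫_ℝ = fderiv ℝ (fderiv ℝ w) y v u := by
  have h : fderiv ℝ w = fun y => innerSL ℝ (gradient w y) := by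
    ext y v; exact fderiv_apply_eq_inner_gradient y v
  have hd : HasFDerivAt (gradient w) (fderiv ℝ (gradient w) y) y :=
    ((contDiff_gradient hw).differentiable one_ne_zero y).hasFDerivAt
  have h2 := (innerSL ℝ (E := EuclideanSpace ℝ (Fin n))).hasFDerivAt.comp y hd
  change HasFDerivAt (fun y => innerSL ℝ (gradient w y)) _ y at h2
  rw [← h] at h2
  rw [h2.fderiv]
  rfl

/-- Symmetry of the Hessian, which cancels the second-order terms in `divergence_energyFlux`. -/
lemma inner_fderiv_gradient_comm (hw : ContDiff ℝ 2 w) (y v u : EuclideanSpace ℝ (Fin n)) :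
    ⟪fderiv ℝ (gradient w) y v, u⟫_ℝ = ⟪fderiv ℝ (gradient w) y u, v⟫_ℝ := by
  rw [inner_fderiv_gradient hw, inner_fderiv_gradient hw]
  exact (hw.contDiffAt.isSymmSndFDerivAt (by simp)) v u

lemma divergence_gradient (hw : ContDiff ℝ 2 w) (y : EuclideanSpace ℝ (Fin n)) :
    divergence (gradient w) y = Laplacian.laplacian w y := by
  rw [InnerProductSpace.laplacian_eq_iteratedFDeriv_orthonormalBasis w
    (EuclideanSpace.basisFun (Fin n) ℝ)]
  refine Finset.sum_congr rfl fun i _ => ?_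
  rw [iteratedFDeriv_two_apply]
  simp only [EuclideanSpace.basisFun_apply, Matrix.cons_val_zero, Matrix.cons_val_one]
  rw [← inner_fderiv_gradient hw]
  simp [EuclideanSpace.inner_single_right]

end Gradient

/-! ### Integrability against Gaussians -/

section GaussianIntegrable

/-- Integrability against every centred Gaussian. -/
def GaussianIntegrable (f : EuclideanSpace ℝ (Fin n) → ℝ) : Prop :=
  ∀ c : ℝ, 0 < c → Integrable (fun y => f y * Real.exp (-c * ‖y‖ ^ 2))

lemma GaussianIntegrable.one : GaussianIntegrable (n := n) (fun _ => 1) := by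
  intro c hc
  have h := (GaussianFourier.integrable_cexp_neg_mul_sq_norm_add (b := c) (by simpa using hc) 0
    (0 : EuclideanSpace ℝ (Fin n))).re
  refine h.congr (.of_forall fun y => ?_)
  simp only [inner_zero_left, Complex.ofReal_zero, mul_zero, add_zero, one_mul]
  rw [← Complex.exp_ofReal_re]
  push_cast
  rfl

/-- Half of the Gaussian rate absorbs the quadratic weight, by x + 1 ≤ exp x at x = c r²/2. -/
lemma one_add_sq_mul_exp_le {c r : ℝ} (hc : 0 < c) :
    (1 + r ^ 2) * Real.exp (-c * r ^ 2) ≤ (1 + 2 / c) * Real.exp (-(c / 2) * r ^ 2) := by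
  have h1 : 1 + r ^ 2 ≤ (1 + 2 / c) * Real.exp (c / 2 * r ^ 2) := by
    have h2 := Real.add_one_le_exp (c / 2 * r ^ 2)
    have h3 : 1 ≤ Real.exp (c / 2 * r ^ 2) := Real.one_le_exp (by positivity)
    have h4 : r ^ 2 = 2 / c * (c / 2 * r ^ 2) := by field_simp
    have h5 : 2 / c * (c / 2 * r ^ 2) ≤ 2 / c * Real.exp (c / 2 * r ^ 2) := by
      gcongr; linarith
    linarith
  calc _ ≤ (1 + 2 / c) * Real.exp (c / 2 * r ^ 2) * Real.exp (-c * r ^ 2) := by gcongr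
    _ = _ := by rw [mul_assoc, ← Real.exp_add]; ring_nf

lemma GaussianIntegrable.mono {f g : EuclideanSpace ℝ (Fin n) → ℝ} (hg : GaussianIntegrable g)
    (hf : Continuous f) {C : ℝ} (h : ∀ y, |f y| ≤ C * g y) : GaussianIntegrable f := by
  intro c hc
  refine ((hg c hc).const_mul C).mono' (by fun_prop) (.of_forall fun y => ?_)
  rw [norm_mul, Real.norm_eq_abs, Real.norm_of_nonneg (Real.exp_pos _).le, ← mul_assoc]
  exact mul_le_mul_of_nonneg_right (h y) (Real.exp_pos _).le

/-- The loss of half the rate is harmless because all rates are allowed, so quadratic weights can be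
added repeatedly. -/
lemma GaussianIntegrable.one_add_sq_mul {g : EuclideanSpace ℝ (Fin n) → ℝ}
    (hg : GaussianIntegrable g) (hc : Continuous g) :
    GaussianIntegrable (fun y => (1 + ‖y‖ ^ 2) * g y) := by
  intro c hc
  refine ((hg (c / 2) (by positivity)).norm.const_mul (1 + 2 / c)).mono' (by fun_prop)
    (.of_forall fun y => ?_)
  have := mul_le_mul_of_nonneg_left (one_add_sq_mul_exp_le (r := ‖y‖) hc) (abs_nonneg (g y))
  simp only [norm_mul, Real.norm_eq_abs, Real.abs_exp]
  rw [abs_of_nonneg (by positivity : (0 : ℝ) ≤ 1 + ‖y‖ ^ 2)]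
  linarith

end GaussianIntegrable

/-! ### Caccioppoli estimate for the gradient -/

section Caccioppoli

variable {w : EuclideanSpace ℝ (Fin n) → ℝ} {p : ℝ}

lemma IsSelfSimilarSolution.laplacian_eq (hw : IsSelfSimilarSolution p w)
    (y : EuclideanSpace ℝ (Fin n)) :
    Laplacian.laplacian w y
      = 1 / 2 * ⟪y, gradient w y⟫_ℝ + 1 / (p - 1) * w y - |w y| ^ (p - 1) * w y := by
  linarith [hw.2 y]

lemma abs_rpow_sub_one_mul_sq (hp : 1 < p) (x : ℝ) : |x| ^ (p - 1) * x * x = |x| ^ (p + 1) := by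
  rw [mul_assoc, ← abs_mul_abs_self, ← pow_two]
  rcases eq_or_ne x 0 with rfl | hx
  · simp [Real.zero_rpow (by linarith : p + 1 ≠ 0)]
  · rw [← Real.rpow_natCast, ← Real.rpow_add (abs_pos.2 hx)]
    congr 1; push_cast; ring

lemma hasFDerivAt_exp_neg_mul_sq (c : ℝ) (y : EuclideanSpace ℝ (Fin n)) :
    HasFDerivAt (fun y : EuclideanSpace ℝ (Fin n) => Real.exp (-c * ‖y‖ ^ 2))
      ((Real.exp (-c * ‖y‖ ^ 2) * (-(2 * c))) • innerSL ℝ y) y := by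
  have h := ((hasStrictFDerivAt_norm_sq y).hasFDerivAt.const_mul (-c)).exp
  refine h.congr_fderiv ?_
  ext v
  simp
  ring

/-- The equation tested with w times a Gaussian. In the coefficient of the cross term, 1/2 comes
from the drift and -2c from the Gaussian; it vanishes only for the rate c = 1/4 of ρ. -/
lemma divergence_gaussian_mul_gradient (hw : IsSelfSimilarSolution p w) (hp : 1 < p) (c : ℝ)
    (y : EuclideanSpace ℝ (Fin n)) :
    divergence (fun y => (w y * Real.exp (-c * ‖y‖ ^ 2)) • gradient w y) y
      = Real.exp (-c * ‖y‖ ^ 2) * (‖gradient w y‖ ^ 2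
        + (1 / 2 - 2 * c) * (w y * ⟪y, gradient w y⟫_ℝ) + 1 / (p - 1) * w y ^ 2
        - |w y| ^ (p + 1)) := by
  have hd : HasFDerivAt w (fderiv ℝ w y) y := (hw.1.differentiable two_ne_zero y).hasFDerivAt
  have h := hd.fun_mul (hasFDerivAt_exp_neg_mul_sq c y)
  rw [divergence_smul h.differentiableAt
    ((contDiff_gradient hw.1).differentiable one_ne_zero y), divergence_gradient hw.1,
    hw.laplacian_eq, ← abs_rpow_sub_one_mul_sq hp]
  have h' : fderiv ℝ (fun y => w y * Real.exp (-c * ‖y‖ ^ 2)) y (gradient w y)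
      = Real.exp (-c * ‖y‖ ^ 2) * (‖gradient w y‖ ^ 2
        - 2 * c * (w y * ⟪y, gradient w y⟫_ℝ)) := by
    rw [h.fderiv]
    simp only [add_apply, smul_apply, smul_eq_mul,
      innerSL_apply_apply, fderiv_apply_eq_inner_gradient, real_inner_self_eq_norm_sq]
    ring
  rw [h']
  ring

/-- Pointwise absorption: by Young's inequality the drift term A and the cutoff term B each cost a
quarter of the gradient term, leaving one half. The term S is dropped by sign and the power P is
bounded by N. -/
lemma caccioppoli_aux {c C M N P S A B η g r : ℝ} (hη0 : 0 ≤ η) (hη1 : η ≤ 1)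
    (hpow : P ≤ N) (hw2 : 0 ≤ S) (hA' : -((1 / 2 + 2 * c) * (M * (r * g))) ≤ A)
    (hB' : -(M * (C * g)) ≤ B) (hN : 0 ≤ N) :
    η * η * (1 / 2 * g ^ 2) - (((1 / 2 + 2 * c) * M) ^ 2 + N + 4 * C ^ 2 * M ^ 2) * (1 + r ^ 2) ≤
          η * η * (g ^ 2 + A + S - P) + 2 * η * B := by
  have hη2' : η * η ≤ 1 := by nlinarith
  have hηη : 0 ≤ η * η := by positivity
  have hA : -(1 / 4 * g ^ 2 + ((1 / 2 + 2 * c) * M) ^ 2 * r ^ 2) ≤ A := by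
    have := hA'
    nlinarith [sq_nonneg (1 / 2 * g - ((1 / 2 + 2 * c) * M) * r)]
  have hB : -(1 / 4 * (η * η) * g ^ 2 + 4 * C ^ 2 * M ^ 2) ≤ 2 * η * B := by
    have h1 := hB'
    have h2 : 2 * η * (-(M * (C * g))) ≤ 2 * η * B := by gcongr
    nlinarith [sq_nonneg (1 / 2 * η * g - 2 * C * M)]
  have h1 : η * η * (g ^ 2 - (1 / 4 * g ^ 2 + ((1 / 2 + 2 * c) * M) ^ 2 * r ^ 2)
      - N) ≤
      η * η * (g ^ 2 + A + S - P) := by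
    gcongr
    linarith
  have h2 : η * η * (((1 / 2 + 2 * c) * M) ^ 2 * r ^ 2 + N) ≤
      ((1 / 2 + 2 * c) * M) ^ 2 * r ^ 2 + N :=
    mul_le_of_le_one_left (by positivity) hη2'
  have h3 : ((1 / 2 + 2 * c) * M) ^ 2 * r ^ 2 + N + 4 * C ^ 2 * M ^ 2
      ≤ (((1 / 2 + 2 * c) * M) ^ 2 + N + 4 * C ^ 2 * M ^ 2) * (1 + r ^ 2) := by
    have e1 : 0 ≤ ((1 / 2 + 2 * c) * M) ^ 2 := sq_nonneg _
    have e2 : 0 ≤ (N + 4 * C ^ 2 * M ^ 2) * r ^ 2 := by positivity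
    linarith
  linarith

/-- A Caccioppoli estimate: the gradient of a bounded solution is square integrable against every
Gaussian. -/
theorem gaussianIntegrable_gradient_sq (hw : IsSelfSimilarSolution p w) (hp : 1 < p) {M : ℝ}
    (hM : ∀ y, |w y| ≤ M) : GaussianIntegrable (fun y => ‖gradient w y‖ ^ 2) := by
  intro c hc
  have hM0 : 0 ≤ M := (abs_nonneg _).trans (hM 0)
  have hwc : Continuous w := hw.1.continuous
  have hgc : Continuous (gradient w) := (contDiff_gradient hw.1).continuous
  obtain ⟨C, hC0, hC⟩ := exists_norm_fderiv_cutoff_le (n := n)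
  set e : EuclideanSpace ℝ (Fin n) → ℝ := fun y => Real.exp (-c * ‖y‖ ^ 2) with he
  have he0 (y) : 0 < e y := Real.exp_pos _
  have hec : ContDiff ℝ 1 e := by
    rw [he]; exact ((contDiff_norm_sq ℝ).const_smul (-c)).exp
  set W : EuclideanSpace ℝ (Fin n) → EuclideanSpace ℝ (Fin n) :=
    fun y => (w y * e y) • gradient w y with hWdef
  have hW : ContDiff ℝ 1 W :=
    ((hw.1.of_le one_le_two).mul hec).smul (contDiff_gradient hw.1)
  have hWc := hW.continuous
  set K := ((1 / 2 + 2 * c) * M) ^ 2 + M ^ (p + 1) + 4 * C ^ 2 * M ^ 2 with hK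
  have hK0 : 0 ≤ K := by positivity
  have hpoly : Integrable (fun y : EuclideanSpace ℝ (Fin n) => K * ((1 + ‖y‖ ^ 2) * 1 * e y)) :=
    (GaussianIntegrable.one.one_add_sq_mul continuous_const c hc).const_mul K
  -- The cutoff enters squared so that its derivative keeps one factor η, which is paired with |∇w|
  -- in Young's inequality.
  have hη2 (k : ℕ) : ContDiff ℝ 1 (fun y : EuclideanSpace ℝ (Fin n) => cutoff k y * cutoff k y) :=
    (contDiff_cutoff k).mul (contDiff_cutoff k)
  have hηs (k : ℕ) : HasCompactSupport
      (fun y : EuclideanSpace ℝ (Fin n) => cutoff k y * cutoff k y) :=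
    (hasCompactSupport_cutoff k).mul_right
  have hηd (k : ℕ) (y v : EuclideanSpace ℝ (Fin n)) :
      fderiv ℝ (fun y => cutoff k y * cutoff k y) y v = 2 * cutoff k y * fderiv ℝ (cutoff k) y v := by
    have := ((contDiff_cutoff (n := n) k).differentiable one_ne_zero y).hasFDerivAt
    rw [(this.fun_mul this).fderiv]
    simp
    ring
  have hsupp (k : ℕ) {g : EuclideanSpace ℝ (Fin n) → ℝ} (hg : Continuous g) :
      Integrable (fun y => cutoff k y * cutoff k y * g y) :=
    ((hη2 k).continuous.mul hg).integrable_of_hasCompactSupport (hηs k).mul_right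
  have hbound (k : ℕ) : ∫ y, cutoff k y * cutoff k y * (1 / 2 * (‖gradient w y‖ ^ 2 * e y))
      ≤ ∫ y, K * ((1 + ‖y‖ ^ 2) * 1 * e y) := by
    have hI := integral_mul_divergence (hη2 k) (hηs k) hW
    have hi1 := hsupp k (continuous_divergence hW)
    have hi2 : Integrable (fun y => fderiv ℝ (fun y => cutoff k y * cutoff k y) y (W y)) := by
      have := (hη2 k).continuous_fderiv one_ne_zero
      refine Continuous.integrable_of_hasCompactSupport (by fun_prop)
        (((hηs k).fderiv ℝ).mono fun y hy h => hy ?_)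
      simp [h]
    have h0 : ∫ y, (cutoff k y * cutoff k y * divergence W y
        + fderiv ℝ (fun y => cutoff k y * cutoff k y) y (W y)) = 0 := by
      rw [integral_add hi1 hi2, hI]; ring
    have h1 : ∫ y, (cutoff k y * cutoff k y * (1 / 2 * (‖gradient w y‖ ^ 2 * e y))
        - K * ((1 + ‖y‖ ^ 2) * 1 * e y)) ≤ 0 := by
      rw [← h0]
      refine integral_mono ((hsupp k (by fun_prop)).sub hpoly) (hi1.add hi2) fun y => ?_
      simp only
      have hη0 := cutoff_nonneg k y
      have hη1 := cutoff_le_one k y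
      rw [hηd, hWdef, divergence_gaussian_mul_gradient hw hp c y, map_smul, smul_eq_mul]
      change _ ≤ cutoff k y * cutoff k y * (e y * _) + _
      set η := cutoff k y
      set g := ‖gradient w y‖ with hg
      set r := ‖y‖
      have hg0 : 0 ≤ g := norm_nonneg _
      have hr0 : 0 ≤ r := norm_nonneg _
      -- A bound uniform in k is enough here; the decay 1/(k+1) is discarded.
      have hq : |fderiv ℝ (cutoff k) y (gradient w y)| ≤ C * g := by
        refine ((fderiv ℝ (cutoff k) y).le_opNorm _).trans ?_
        gcongr
        exact (hC k y).trans (div_le_self hC0 (by linarith [Nat.cast_nonneg (α := ℝ) k]))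
      have hq2 : |w y * fderiv ℝ (cutoff k) y (gradient w y)| ≤ M * (C * g) := by
        rw [abs_mul]; gcongr; exact hM y
      have hip : |w y * ⟪y, gradient w y⟫_ℝ| ≤ M * (r * g) := by
        rw [abs_mul]; gcongr
        · exact hM y
        · exact abs_real_inner_le_norm _ _
      have hpow : |w y| ^ (p + 1) ≤ M ^ (p + 1) := by gcongr; exact hM y
      have hc2 : |(1 / 2 - 2 * c) * (w y * ⟪y, gradient w y⟫_ℝ)| ≤
          (1 / 2 + 2 * c) * (M * (r * g)) := by
        rw [abs_mul]
        gcongr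
        rw [abs_le]; constructor <;> linarith
      have hw2 : 0 ≤ 1 / (p - 1) * w y ^ 2 :=
        mul_nonneg (one_div_nonneg.2 (by linarith)) (sq_nonneg _)
      set A := (1 / 2 - 2 * c) * (w y * ⟪y, gradient w y⟫_ℝ)
      set B := w y * fderiv ℝ (cutoff k) y (gradient w y)
      have hmain := caccioppoli_aux (N := M ^ (p + 1)) hη0 hη1 hpow hw2 (abs_le.1 hc2).1
        (abs_le.1 hq2).1 (by positivity) (r := r) (g := g)
      have := mul_le_mul_of_nonneg_right hmain (he0 y).le
      calc _ = (η * η * (1 / 2 * g ^ 2) - K * (1 + r ^ 2)) * e y := by ring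
        _ ≤ _ := this
        _ = _ := by ring
    rw [integral_sub (hsupp k (by fun_prop)) hpoly] at h1
    linarith
  set I := ∫ y, K * ((1 + ‖y‖ ^ 2) * 1 * e y)
  -- The bound 2I does not depend on k, so exhausting the space by balls gives integrability.
  have hcover := aecover_closedBall (μ := (volume : Measure (EuclideanSpace ℝ (Fin n))))
    (x := 0) tendsto_natCast_atTop_atTop
  have hfc : Continuous fun y => ‖gradient w y‖ ^ 2 * e y := by fun_prop
  refine hcover.integrable_of_integral_norm_bounded (2 * I) (fun k =>
    (hfc.continuousOn.integrableOn_compact (isCompact_closedBall _ _)))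
    (.of_forall fun k => ?_)
  have hint := hsupp k (g := fun y => 1 / 2 * (‖gradient w y‖ ^ 2 * e y)) (by fun_prop)
  have hnn (y) : 0 ≤ cutoff k y * cutoff k y * (1 / 2 * (‖gradient w y‖ ^ 2 * e y)) := by
    have := cutoff_nonneg k y
    have := (he0 y).le
    positivity
  calc _ = ∫ y in Metric.closedBall 0 (k : ℝ),
        2 * (cutoff k y * cutoff k y * (1 / 2 * (‖gradient w y‖ ^ 2 * e y))) := by
        refine setIntegral_congr_fun Metric.isClosed_closedBall.measurableSet fun y hy => ?_
        have := (he0 y).le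
        simp only [cutoff_eq_one ((mem_closedBall_zero_iff.1 hy).trans (by linarith) : ‖y‖ ≤ k + 1)]
        rw [Real.norm_of_nonneg (by positivity)]
        ring
    _ ≤ ∫ y, 2 * (cutoff k y * cutoff k y * (1 / 2 * (‖gradient w y‖ ^ 2 * e y))) :=
        setIntegral_le_integral (hint.const_mul 2)
          (.of_forall fun y => mul_nonneg zero_le_two (hnn y))
    _ ≤ 2 * I := by rw [integral_const_mul]; linarith [hbound k]

end Caccioppoli

/-! ### Heat kernels along the curve -/

section Kernel

variable (X : EuclideanSpace ℝ (Fin n)) (T : ℝ)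

/-- The heat kernel centred at the point `(sX, -(1 + T s²))`. -/
def curveKernel (s : ℝ) (y : EuclideanSpace ℝ (Fin n)) : ℝ :=
  heatKernel (y - s • X) (-(1 + T * s ^ 2))

/-- The logarithmic derivative of `curveKernel X T s y` in `s`. -/
def curveKernelRate (s : ℝ) (y : EuclideanSpace ℝ (Fin n)) : ℝ :=
  ⟪y - s • X, X⟫_ℝ / (2 * (1 + T * s ^ 2)) + 2 * T * s *
    (-(n : ℝ) / (2 * (1 + T * s ^ 2)) + ‖y - s • X‖ ^ 2 / (4 * (1 + T * s ^ 2) ^ 2))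

variable {X T}

lemma curveKernel_eq (s : ℝ) (y : EuclideanSpace ℝ (Fin n)) :
    curveKernel X T s y = (4 * Real.pi * (1 + T * s ^ 2)) ^ (-(n : ℝ) / 2) *
      Real.exp (-(‖y - s • X‖ ^ 2 / (4 * (1 + T * s ^ 2)))) := by
  rw [curveKernel, heatKernel, ← div_neg]
  congr 2 <;> ring_nf

/-- 1 + T s² is the convex combination of 1 and 1 + T with weights 1 - s² and s². -/
lemma one_add_mul_sq_mem {s : ℝ} (hs : s ∈ Set.Icc (0 : ℝ) 1) :
    min 1 (1 + T) ≤ 1 + T * s ^ 2 ∧ 1 + T * s ^ 2 ≤ max 1 (1 + T) := by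
  have h0 : 0 ≤ s ^ 2 := sq_nonneg s
  have h1 : s ^ 2 ≤ 1 := pow_le_one₀ hs.1 hs.2
  rcases le_total 0 T with h | h
  · exact ⟨(min_le_left _ _).trans (by nlinarith), le_trans (by nlinarith) (le_max_right _ _)⟩
  · exact ⟨(min_le_right _ _).trans (by nlinarith), le_trans (by nlinarith) (le_max_left _ _)⟩

lemma one_add_mul_sq_pos (hT : -1 < T) {s : ℝ} (hs : s ∈ Set.Icc (0 : ℝ) 1) :
    0 < 1 + T * s ^ 2 :=
  lt_of_lt_of_le (lt_min one_pos (by linarith)) (one_add_mul_sq_mem hs).1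

lemma curveKernel_pos (hT : -1 < T) {s : ℝ} (hs : s ∈ Set.Icc (0 : ℝ) 1)
    (y : EuclideanSpace ℝ (Fin n)) : 0 < curveKernel X T s y := by
  have := one_add_mul_sq_pos hT hs
  rw [curveKernel_eq]
  have := Real.pi_pos
  positivity

lemma hasDerivAt_curveKernel {s : ℝ} (hs : 0 < 1 + T * s ^ 2) (y : EuclideanSpace ℝ (Fin n)) :
    HasDerivAt (fun s => curveKernel X T s y)
      (curveKernel X T s y * curveKernelRate X T s y) s := by
  have hτ : HasDerivAt (fun s : ℝ => 1 + T * s ^ 2) (2 * T * s) s := by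
    refine (((hasDerivAt_pow 2 s).const_mul T).const_add 1).congr_deriv ?_
    simp; ring
  have hz : HasDerivAt (fun s : ℝ => y - s • X) (-X) s := by
    simpa using ((hasDerivAt_id s).smul_const X).const_sub y
  have hn := hz.norm_sq
  have h4 : 0 < 4 * Real.pi * (1 + T * s ^ 2) := by have := Real.pi_pos; positivity
  have h1 := (hτ.const_mul (4 * Real.pi)).rpow_const (p := -(n : ℝ) / 2) (Or.inl h4.ne')
  have h2 := (hn.fun_div (hτ.const_mul 4) (by positivity)).fun_neg.exp
  have h := h1.fun_mul h2
  simp only [← curveKernel_eq] at h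
  refine h.congr_deriv ?_
  rw [Real.rpow_sub_one h4.ne', curveKernel_eq, curveKernelRate, inner_neg_right]
  have := Real.pi_pos
  field_simp
  ring

lemma continuous_curveKernel (s : ℝ) : Continuous (curveKernel X T s) := by
  unfold curveKernel heatKernel
  fun_prop

lemma continuous_curveKernelRate (s : ℝ) : Continuous (curveKernelRate X T s) := by
  unfold curveKernelRate
  fun_prop

/-- A single Gaussian dominates all kernels of the curve, as dominated convergence in s requires.
The prefactor is worst at the smallest τ and the exponent at the largest; |y|² ≤ 2|y - sX|² + 2|X|²
turns the rate 1/(4M) into 1/(8M). -/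
lemma exists_curveKernel_le (X : EuclideanSpace ℝ (Fin n)) (hT : -1 < T) :
    ∃ C c : ℝ, 0 ≤ C ∧ 0 < c ∧ ∀ s ∈ Set.Icc (0 : ℝ) 1, ∀ y : EuclideanSpace ℝ (Fin n),
      curveKernel X T s y ≤ C * Real.exp (-c * ‖y‖ ^ 2) := by
  set m := min 1 (1 + T) with hm
  set M := max 1 (1 + T) with hM
  have hm0 : 0 < m := lt_min one_pos (by linarith)
  have hM0 : 0 < M := lt_of_lt_of_le one_pos (le_max_left _ _)
  have hpi := Real.pi_pos
  refine ⟨(4 * Real.pi * m) ^ (-(n : ℝ) / 2) * Real.exp (‖X‖ ^ 2 / (4 * M)), 1 / (8 * M),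
    by positivity, by positivity, fun s hs y => ?_⟩
  obtain ⟨h1, h2⟩ := one_add_mul_sq_mem (T := T) hs
  rw [curveKernel_eq, mul_assoc (_ ^ _), ← Real.exp_add]
  have hτ : 0 < 1 + T * s ^ 2 := hm0.trans_le h1
  refine mul_le_mul ?_ ?_ (Real.exp_pos _).le (by positivity)
  · refine Real.rpow_le_rpow_of_nonpos (by positivity) (by gcongr) ?_
    have : (0 : ℝ) ≤ n := n.cast_nonneg
    linarith
  · rw [Real.exp_le_exp]
    have h3 : ‖y‖ ^ 2 ≤ 2 * ‖y - s • X‖ ^ 2 + 2 * ‖X‖ ^ 2 := by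
      have h4 : ‖y‖ ≤ ‖y - s • X‖ + ‖s • X‖ := by
        simpa using norm_add_le (y - s • X) (s • X)
      have h5 : ‖s • X‖ ≤ ‖X‖ := by
        rw [norm_smul, Real.norm_of_nonneg hs.1]
        exact mul_le_of_le_one_left (norm_nonneg _) hs.2
      have h6 : ‖y‖ ^ 2 ≤ (‖y - s • X‖ + ‖X‖) ^ 2 := by gcongr; linarith
      nlinarith [sq_nonneg (‖y - s • X‖ - ‖X‖)]
    have h7 : ‖y - s • X‖ ^ 2 / (4 * M) ≤ ‖y - s • X‖ ^ 2 / (4 * (1 + T * s ^ 2)) := by gcongr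
    have h8 : ‖y‖ ^ 2 / (8 * M) ≤ (2 * ‖y - s • X‖ ^ 2 + 2 * ‖X‖ ^ 2) / (8 * M) := by gcongr
    have h9 : (2 * ‖y - s • X‖ ^ 2 + 2 * ‖X‖ ^ 2) / (8 * M)
        = ‖y - s • X‖ ^ 2 / (4 * M) + ‖X‖ ^ 2 / (4 * M) := by field_simp; ring
    have h10 : -(1 / (8 * M)) * ‖y‖ ^ 2 = -(‖y‖ ^ 2 / (8 * M)) := by ring
    linarith

lemma norm_sub_smul_le {s : ℝ} (hs : s ∈ Set.Icc (0 : ℝ) 1) (y X : EuclideanSpace ℝ (Fin n)) :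
    ‖y - s • X‖ ≤ ‖y‖ + ‖X‖ := by
  refine (norm_sub_le _ _).trans ?_
  gcongr
  rw [norm_smul, Real.norm_of_nonneg hs.1]
  exact mul_le_of_le_one_left (norm_nonneg _) hs.2

lemma exists_abs_curveKernelRate_le (X : EuclideanSpace ℝ (Fin n)) (hT : -1 < T) :
    ∃ C : ℝ, 0 ≤ C ∧ ∀ s ∈ Set.Icc (0 : ℝ) 1, ∀ y : EuclideanSpace ℝ (Fin n),
      |curveKernelRate X T s y| ≤ C * (1 + ‖y‖ ^ 2) := by
  set m := min 1 (1 + T) with hm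
  have hm0 : 0 < m := lt_min one_pos (by linarith)
  refine ⟨(1 + ‖X‖) * ‖X‖ / (2 * m) + 2 * |T| * (n / (2 * m)
    + 2 * (1 + ‖X‖) ^ 2 / (4 * m ^ 2)), by positivity, fun s hs y => ?_⟩
  obtain ⟨h1, -⟩ := one_add_mul_sq_mem (T := T) hs
  have hz := norm_sub_smul_le hs y X
  have hτ : 0 < 1 + T * s ^ 2 := hm0.trans_le h1
  set r := ‖y‖ with hr
  have hr0 : 0 ≤ r := norm_nonneg _
  have hX0 : 0 ≤ ‖X‖ := norm_nonneg _
  have hz1 : ‖y - s • X‖ ≤ (1 + ‖X‖) * (1 + r ^ 2) := by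
    nlinarith [sq_nonneg (r - 1), mul_nonneg hX0 (sq_nonneg r)]
  have hz2 : ‖y - s • X‖ ^ 2 ≤ 2 * (1 + ‖X‖) ^ 2 * (1 + r ^ 2) := by
    have : ‖y - s • X‖ ^ 2 ≤ (r + ‖X‖) ^ 2 := by gcongr
    have : (0 : ℝ) ≤ ‖X‖ * r ^ 2 := by positivity
    have : (0 : ℝ) ≤ ‖X‖ ^ 2 * r ^ 2 := by positivity
    nlinarith [sq_nonneg (r - ‖X‖)]
  have b1 : |⟪y - s • X, X⟫_ℝ / (2 * (1 + T * s ^ 2))| ≤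
      (1 + ‖X‖) * (1 + r ^ 2) * ‖X‖ / (2 * m) := by
    rw [abs_div, abs_of_pos (by positivity : 0 < 2 * (1 + T * s ^ 2))]
    refine div_le_div₀ (by positivity) ((abs_real_inner_le_norm _ _).trans ?_) (by positivity)
      (by gcongr)
    gcongr
  have b2 : |-(n : ℝ) / (2 * (1 + T * s ^ 2))| ≤ n / (2 * m) * (1 + r ^ 2) := by
    rw [neg_div, abs_neg, abs_of_nonneg (by positivity)]
    refine le_trans (?_ : _ ≤ (n : ℝ) / (2 * m)) (le_mul_of_one_le_right (by positivity) ?_)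
    · gcongr
    · nlinarith
  have b3 : |‖y - s • X‖ ^ 2 / (4 * (1 + T * s ^ 2) ^ 2)| ≤
      2 * (1 + ‖X‖) ^ 2 * (1 + r ^ 2) / (4 * m ^ 2) := by
    rw [abs_of_nonneg (by positivity)]
    gcongr
  have b4 : |2 * T * s| ≤ 2 * |T| := by
    rw [abs_mul, abs_mul, abs_of_nonneg hs.1, abs_two]
    exact mul_le_of_le_one_right (by positivity) hs.2
  rw [curveKernelRate]
  calc _ ≤ (1 + ‖X‖) * (1 + r ^ 2) * ‖X‖ / (2 * m) + 2 * |T| * (n / (2 * m) * (1 + r ^ 2)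
        + 2 * (1 + ‖X‖) ^ 2 * (1 + r ^ 2) / (4 * m ^ 2)) := by
        refine (abs_add_le _ _).trans (add_le_add b1 ?_)
        rw [abs_mul]
        exact mul_le_mul b4 ((abs_add_le _ _).trans (add_le_add b2 b3)) (abs_nonneg _)
          (by positivity)
    _ = _ := by ring

lemma GaussianIntegrable.mul_curveKernel {f : EuclideanSpace ℝ (Fin n) → ℝ}
    (hf : GaussianIntegrable f) (hfc : Continuous f) (hT : -1 < T) {s : ℝ}
    (hs : s ∈ Set.Icc (0 : ℝ) 1) : Integrable (fun y => f y * curveKernel X T s y) := by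
  obtain ⟨C, c, hC0, hc, hC⟩ := exists_curveKernel_le X hT
  have hk := continuous_curveKernel (X := X) (T := T) s
  refine ((hf c hc).norm.const_mul C).mono' (by fun_prop) (.of_forall fun y => ?_)
  rw [norm_mul, norm_mul, Real.norm_of_nonneg (curveKernel_pos hT hs y).le,
    Real.norm_of_nonneg (Real.exp_pos _).le]
  calc _ ≤ ‖f y‖ * (C * Real.exp (-c * ‖y‖ ^ 2)) := by gcongr; exact hC s hs y
    _ = _ := by ring

/-- Covers the endpoints, where the derivative in s is not computed. -/
lemma continuousOn_integral_mul_curveKernel {f : EuclideanSpace ℝ (Fin n) → ℝ}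
    (hf : GaussianIntegrable f) (hfc : Continuous f) (hT : -1 < T) :
    ContinuousOn (fun s => ∫ y, f y * curveKernel X T s y) (Set.Icc 0 1) := by
  obtain ⟨C, c, hC0, hc, hC⟩ := exists_curveKernel_le X hT
  refine continuousOn_of_dominated (bound := fun y => C * ‖f y * Real.exp (-c * ‖y‖ ^ 2)‖)
    (fun s hs => (hf.mul_curveKernel hfc hT hs).aestronglyMeasurable)
    (fun s hs => .of_forall fun y => ?_) ((hf c hc).norm.const_mul C) (.of_forall fun y s hs => ?_)
  · rw [norm_mul, norm_mul, Real.norm_of_nonneg (curveKernel_pos hT hs y).le,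
      Real.norm_of_nonneg (Real.exp_pos _).le]
    calc _ ≤ ‖f y‖ * (C * Real.exp (-c * ‖y‖ ^ 2)) := by gcongr; exact hC s hs y
      _ = _ := by ring
  · exact ((hasDerivAt_curveKernel (one_add_mul_sq_pos hT hs) y).continuousAt.const_mul
      (f y)).continuousWithinAt

lemma hasDerivAt_integral_mul_curveKernel {f : EuclideanSpace ℝ (Fin n) → ℝ}
    (hf : GaussianIntegrable f) (hfc : Continuous f) (hT : -1 < T) {s : ℝ}
    (hs : s ∈ Set.Ioo (0 : ℝ) 1) :
    Integrable (fun y => f y * (curveKernel X T s y * curveKernelRate X T s y)) ∧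
    HasDerivAt (fun s => ∫ y, f y * curveKernel X T s y)
      (∫ y, f y * (curveKernel X T s y * curveKernelRate X T s y)) s := by
  obtain ⟨C, c, hC0, hc, hC⟩ := exists_curveKernel_le X hT
  obtain ⟨D, hD0, hD⟩ := exists_abs_curveKernelRate_le X hT
  -- The majorant: the Gaussian bound for the kernel times the quadratic bound for its logarithmic
  -- derivative.
  have hI := ((hf.one_add_sq_mul hfc) c hc).norm.const_mul (C * D)
  have hkc := continuous_curveKernel (X := X) (T := T) s
  have hrc := continuous_curveKernelRate (X := X) (T := T) s
  refine hasDerivAt_integral_of_dominated_loc_of_deriv_le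
    (F := fun s y => f y * curveKernel X T s y)
    (F' := fun s y => f y * (curveKernel X T s y * curveKernelRate X T s y)) (Ioo_mem_nhds hs.1 hs.2)
    (.of_forall fun t => ?_) (hf.mul_curveKernel hfc hT (Set.Ioo_subset_Icc_self hs)) (by fun_prop)
    (.of_forall fun y t ht => ?_) hI (.of_forall fun y t ht => ?_)
  · have := continuous_curveKernel (X := X) (T := T) t
    fun_prop
  · have ht' := Set.Ioo_subset_Icc_self ht
    rw [norm_mul, norm_mul, Real.norm_of_nonneg (curveKernel_pos hT ht' y).le, norm_mul, norm_mul,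
      Real.norm_of_nonneg (Real.exp_pos _).le,
      Real.norm_of_nonneg (by positivity : 0 ≤ 1 + ‖y‖ ^ 2)]
    calc _ ≤ ‖f y‖ * ((C * Real.exp (-c * ‖y‖ ^ 2)) * (D * (1 + ‖y‖ ^ 2))) := by
          gcongr
          · exact hC t ht' y
          · exact hD t ht' y
      _ = _ := by ring
  · exact (hasDerivAt_curveKernel (one_add_mul_sq_pos hT (Set.Ioo_subset_Icc_self ht))
      y).const_mul (f y)

end Kernel

/-! ### The energy flux and its divergence -/

section Field

variable {w : EuclideanSpace ℝ (Fin n) → ℝ} {p T s : ℝ} {X : EuclideanSpace ℝ (Fin n)}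

/-- The affine vector field `U` with `y - (y - sX) / (1 + T s²) = s U`. -/
def driftField (X : EuclideanSpace ℝ (Fin n)) (T s : ℝ) (y : EuclideanSpace ℝ (Fin n)) :
    EuclideanSpace ℝ (Fin n) :=
  (T * s / (1 + T * s ^ 2)) • (y - s • X) + X

/-- The first order expression in `w` whose weighted `L²` norm is the dissipation of the
functional along the curve `s ↦ (sX, -(1 + T s²))`. -/
def dissipation (p : ℝ) (w : EuclideanSpace ℝ (Fin n) → ℝ) (X : EuclideanSpace ℝ (Fin n))
    (T s : ℝ) (y : EuclideanSpace ℝ (Fin n)) : ℝ :=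
  ⟪driftField X T s y, gradient w y⟫_ℝ + 2 / (p - 1) * (T * s / (1 + T * s ^ 2)) * w y

/-- The scalar factor of the drift in `energyFlux`. -/
def driftCoefficient (p : ℝ) (w : EuclideanSpace ℝ (Fin n) → ℝ) (T s : ℝ)
    (y : EuclideanSpace ℝ (Fin n)) : ℝ :=
  -(1 / 2) * ‖gradient w y‖ ^ 2 + 1 / (p + 1) * |w y| ^ (p + 1)
    + 1 / (2 * (p - 1)) * (s * (T * s / (1 + T * s ^ 2)) - 1) * w y ^ 2

/-- The vector field whose weighted divergence expresses the derivative of the functional. -/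
def energyFlux (p : ℝ) (w : EuclideanSpace ℝ (Fin n) → ℝ) (X : EuclideanSpace ℝ (Fin n))
    (T s : ℝ) (y : EuclideanSpace ℝ (Fin n)) : EuclideanSpace ℝ (Fin n) :=
  dissipation p w X T s y • gradient w y + driftCoefficient p w T s y • driftField X T s y

lemma hasFDerivAt_driftField (y : EuclideanSpace ℝ (Fin n)) :
    HasFDerivAt (driftField X T s)
      ((T * s / (1 + T * s ^ 2)) • ContinuousLinearMap.id ℝ (EuclideanSpace ℝ (Fin n))) y := by
  unfold driftField
  exact (((hasFDerivAt_id y).sub_const _).fun_const_smul _).add_const _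

lemma contDiff_driftField : ContDiff ℝ 1 (driftField X T s) := by
  unfold driftField
  fun_prop

lemma contDiff_dissipation (hw : ContDiff ℝ 2 w) : ContDiff ℝ 1 (dissipation p w X T s) :=
  (contDiff_driftField.inner ℝ (contDiff_gradient hw)).add
    (contDiff_const.mul (hw.of_le one_le_two))

lemma contDiff_abs_rpow (hw : ContDiff ℝ 2 w) (hp : 1 < p) :
    ContDiff ℝ 1 fun y => |w y| ^ (p + 1) := by
  simpa only [Real.norm_eq_abs] using (hw.of_le one_le_two).norm_rpow (by linarith : 1 < p + 1)

lemma contDiff_driftCoefficient (hw : ContDiff ℝ 2 w) (hp : 1 < p) :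
    ContDiff ℝ 1 (driftCoefficient p w T s) :=
  ((contDiff_const.mul ((contDiff_gradient hw).norm_sq ℝ)).add
    (contDiff_const.mul (contDiff_abs_rpow hw hp))).add
    (contDiff_const.mul ((hw.of_le one_le_two).pow 2))

lemma contDiff_energyFlux (hw : ContDiff ℝ 2 w) (hp : 1 < p) :
    ContDiff ℝ 1 (energyFlux p w X T s) :=
  ((contDiff_dissipation hw).smul (contDiff_gradient hw)).add
    ((contDiff_driftCoefficient hw hp).smul contDiff_driftField)

lemma contDiff_curveKernel : ContDiff ℝ 1 (curveKernel X T s) := by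
  unfold curveKernel heatKernel
  exact contDiff_const.mul (((contDiff_id.sub contDiff_const).norm_sq ℝ).div_const _).exp

lemma hasFDerivAt_curveKernel (y : EuclideanSpace ℝ (Fin n)) :
    HasFDerivAt (curveKernel X T s)
      ((-curveKernel X T s y / (2 * (1 + T * s ^ 2))) • innerSL ℝ (y - s • X)) y := by
  have h1 : HasFDerivAt (fun y : EuclideanSpace ℝ (Fin n) => ‖y - s • X‖ ^ 2)
      (2 • innerSL ℝ (y - s • X)) y := by
    simpa using ((hasFDerivAt_id y).sub_const (s • X)).norm_sq
  have h := ((h1.mul_const (1 / (4 * -(1 + T * s ^ 2)))).exp).const_mul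
    ((-4 * Real.pi * -(1 + T * s ^ 2)) ^ (-(n : ℝ) / 2))
  have e : curveKernel X T s = fun y => (-4 * Real.pi * -(1 + T * s ^ 2)) ^ (-(n : ℝ) / 2) *
      Real.exp (‖y - s • X‖ ^ 2 * (1 / (4 * -(1 + T * s ^ 2)))) := by
    ext y; rw [curveKernel, heatKernel, mul_one_div]
  rw [← e] at h
  refine h.congr_fderiv ?_
  rw [e]
  ext v
  simp only [smul_apply, innerSL_apply_apply, smul_eq_mul, nsmul_eq_mul]
  generalize (-4 * Real.pi * -(1 + T * s ^ 2)) ^ (-(n : ℝ) / 2) = A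
  generalize Real.exp _ = B
  generalize 1 + T * s ^ 2 = τ
  rw [mul_neg 4 τ, div_neg]
  push_cast
  ring

lemma fderiv_dissipation (hw : ContDiff ℝ 2 w) (y v : EuclideanSpace ℝ (Fin n)) :
    fderiv ℝ (dissipation p w X T s) y v
      = T * s / (1 + T * s ^ 2) * ⟪gradient w y, v⟫_ℝ
        + ⟪fderiv ℝ (gradient w) y v, driftField X T s y⟫_ℝ
        + 2 / (p - 1) * (T * s / (1 + T * s ^ 2)) * ⟪gradient w y, v⟫_ℝ := by
  have hd : HasFDerivAt w (fderiv ℝ w y) y := (hw.differentiable two_ne_zero y).hasFDerivAt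
  have hg := ((contDiff_gradient hw).differentiable one_ne_zero y).hasFDerivAt
  have h := ((hasFDerivAt_driftField (X := X) (T := T) (s := s) y).inner ℝ hg).fun_add
    (hd.const_mul (2 / (p - 1) * (T * s / (1 + T * s ^ 2))))
  have h' : fderiv ℝ (dissipation p w X T s) y = _ := h.fderiv
  rw [h']
  simp only [add_apply, smul_apply, ContinuousLinearMap.comp_apply, ContinuousLinearMap.prod_apply,
    fderivInnerCLM_apply, ContinuousLinearMap.id_apply, smul_eq_mul,
    fderiv_apply_eq_inner_gradient, inner_smul_left, RCLike.conj_to_real]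
  rw [real_inner_comm v, real_inner_comm (driftField X T s y)]
  ring

lemma fderiv_driftCoefficient (hw : ContDiff ℝ 2 w) (hp : 1 < p)
    (y v : EuclideanSpace ℝ (Fin n)) :
    fderiv ℝ (driftCoefficient p w T s) y v
      = - ⟪fderiv ℝ (gradient w) y v, gradient w y⟫_ℝ
        + |w y| ^ (p - 1) * w y * ⟪gradient w y, v⟫_ℝ
        + 1 / (p - 1) * (s * (T * s / (1 + T * s ^ 2)) - 1) * w y * ⟪gradient w y, v⟫_ℝ := by
  have hd : HasFDerivAt w (fderiv ℝ w y) y := (hw.differentiable two_ne_zero y).hasFDerivAt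
  have hg := ((contDiff_gradient hw).differentiable one_ne_zero y).hasFDerivAt
  have hP := (hasDerivAt_abs_rpow (w y) (by linarith : 1 < p + 1)).comp_hasFDerivAt y hd
  have h := ((hg.norm_sq.const_mul (-(1 / 2))).fun_add (hP.const_mul (1 / (p + 1)))).fun_add
    ((hd.pow 2).const_mul (1 / (2 * (p - 1)) * (s * (T * s / (1 + T * s ^ 2)) - 1)))
  have h' : fderiv ℝ (driftCoefficient p w T s) y = _ := h.fderiv
  rw [h']
  simp only [add_apply, smul_apply, ContinuousLinearMap.comp_apply, innerSL_apply_apply,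
    smul_eq_mul, nsmul_eq_mul, fderiv_apply_eq_inner_gradient]
  rw [real_inner_comm (gradient w y), show p + 1 - 2 = p - 1 by ring]
  have h1 : p + 1 ≠ 0 := by linarith
  have h2 : p - 1 ≠ 0 := by linarith
  field_simp
  push_cast
  ring

/-- As s·(Ts/τ) - 1 = -1/τ for τ = 1 + T s² ≠ 0, `driftCoefficient` is minus the energy density, and
the flux is the stress tensor applied to U plus a multiple of w∇w. The Hessian terms from D and from
the energy density cancel by symmetry. -/
lemma divergence_energyFlux (hw : ContDiff ℝ 2 w) (hp : 1 < p)
    (y : EuclideanSpace ℝ (Fin n)) :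
    divergence (energyFlux p w X T s) y
      = dissipation p w X T s y * Laplacian.laplacian w y
        + driftCoefficient p w T s y * (n * (T * s / (1 + T * s ^ 2)))
        + (T * s / (1 + T * s ^ 2) * (1 + 2 / (p - 1)) * ‖gradient w y‖ ^ 2
          + (|w y| ^ (p - 1) * w y + 1 / (p - 1) * (s * (T * s / (1 + T * s ^ 2)) - 1) * w y)
            * ⟪driftField X T s y, gradient w y⟫_ℝ) := by
  have h1 := (contDiff_dissipation (p := p) (X := X) (T := T) (s := s) hw).differentiable
    one_ne_zero y
  have h2 := (contDiff_gradient hw).differentiable one_ne_zero y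
  have h3 := (contDiff_driftCoefficient (T := T) (s := s) hw hp).differentiable one_ne_zero y
  have h4 := (contDiff_driftField (X := X) (T := T) (s := s)).differentiable one_ne_zero y
  have h5 : divergence (driftField X T s) y = n * (T * s / (1 + T * s ^ 2)) :=
    divergence_affine _ _ _ _
  have h6 : divergence (energyFlux p w X T s) y = _ := divergence_add (h1.smul h2) (h3.smul h4)
  rw [h6]
  erw [divergence_smul h1 h2, divergence_smul h3 h4]
  rw [divergence_gradient hw, h5, fderiv_dissipation hw, fderiv_driftCoefficient hw hp,
    real_inner_self_eq_norm_sq, inner_fderiv_gradient_comm hw y (driftField X T s y),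
    real_inner_comm (driftField X T s y) (gradient w y)]
  ring

/-- The integrand of the derivative of the functional plus the dissipation is a divergence. -/
lemma divergence_curveKernel_smul_energyFlux (hw : IsSelfSimilarSolution p w) (hp : 1 < p)
    (hτ : 0 < 1 + T * s ^ 2) (y : EuclideanSpace ℝ (Fin n)) :
    divergence (fun y => curveKernel X T s y • energyFlux p w X T s y) y
      = 1 / 2 * (‖gradient w y‖ ^ 2 * (curveKernel X T s y * curveKernelRate X T s y))
        + (p + 1) / (p - 1) * (T * s / (1 + T * s ^ 2)) *
            (‖gradient w y‖ ^ 2 * curveKernel X T s y)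
        - 1 / (p + 1) * (|w y| ^ (p + 1) * (curveKernel X T s y * curveKernelRate X T s y))
        - 2 / (p - 1) * (T * s / (1 + T * s ^ 2)) * (|w y| ^ (p + 1) * curveKernel X T s y)
        + 1 / (2 * (p - 1) * (1 + T * s ^ 2)) *
            (w y ^ 2 * (curveKernel X T s y * curveKernelRate X T s y))
        + 2 / (p - 1) ^ 2 * (T * s / (1 + T * s ^ 2) ^ 2) * (w y ^ 2 * curveKernel X T s y)
        + s / 2 * (dissipation p w X T s y ^ 2 * curveKernel X T s y) := by
  rw [divergence_smul (contDiff_curveKernel.differentiable one_ne_zero y)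
    ((contDiff_energyFlux hw.1 hp).differentiable one_ne_zero y), divergence_energyFlux hw.1 hp,
    (hasFDerivAt_curveKernel y).fderiv, hw.laplacian_eq, ← abs_rpow_sub_one_mul_sq hp]
  -- The drift is split along z = y - sX and X, the vectors in which the kernel and U are written.
  have hy : y = (y - s • X) + s • X := by simp
  have hyg : ⟪y, gradient w y⟫_ℝ = ⟪y - s • X, gradient w y⟫_ℝ + s * ⟪X, gradient w y⟫_ℝ := by
    conv_lhs => rw [hy, inner_add_left, real_inner_smul_left]
    simp
  simp only [smul_apply, innerSL_apply_apply, smul_eq_mul, energyFlux, inner_add_right,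
    real_inner_smul_right, dissipation, driftCoefficient, ← abs_rpow_sub_one_mul_sq hp, hyg,
    curveKernelRate]
  simp only [driftField, inner_add_left, inner_add_right, real_inner_smul_left,
    real_inner_smul_right, real_inner_self_eq_norm_sq]
  -- Once the inner products and powers are independent scalars, the claim is a rational identity.
  generalize ⟪y - s • X, gradient w y⟫_ℝ = zg
  generalize ⟪X, gradient w y⟫_ℝ = xg
  generalize ⟪y - s • X, X⟫_ℝ = zx
  generalize ‖y - s • X‖ = z
  generalize ‖gradient w y‖ = g
  generalize |w y| ^ (p - 1) = P
  generalize curveKernel X T s y = K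
  generalize w y = a
  have h1 : p + 1 ≠ 0 := by linarith
  have h2 : p - 1 ≠ 0 := by linarith
  have h3 := hτ.ne'
  field_simp
  ring

end Field

/-! ### Integrated identity and monotonicity along the curve -/

section Monotonicity

variable {w : EuclideanSpace ℝ (Fin n) → ℝ} {p T s M : ℝ} {X : EuclideanSpace ℝ (Fin n)}

lemma exists_norm_driftField_le (X : EuclideanSpace ℝ (Fin n)) (T s : ℝ) :
    ∃ u : ℝ, 0 ≤ u ∧ ∀ y, ‖driftField X T s y‖ ≤ u * (1 + ‖y‖ ^ 2) := by
  set b := T * s / (1 + T * s ^ 2) with hb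
  refine ⟨|b| * (1 + ‖s • X‖) + ‖X‖, by positivity, fun y => ?_⟩
  have h1 : ‖driftField X T s y‖ ≤ |b| * (‖y‖ + ‖s • X‖) + ‖X‖ := by
    refine (norm_add_le _ _).trans ?_
    rw [norm_smul, Real.norm_eq_abs]
    gcongr
    exact norm_sub_le _ _
  have h2 : ‖y‖ + ‖s • X‖ ≤ (1 + ‖s • X‖) * (1 + ‖y‖ ^ 2) := by
    nlinarith [sq_nonneg (‖y‖ - 1), mul_nonneg (norm_nonneg (s • X)) (sq_nonneg ‖y‖)]
  have h3 : |b| * (‖y‖ + ‖s • X‖) ≤ |b| * ((1 + ‖s • X‖) * (1 + ‖y‖ ^ 2)) := by gcongr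
  have h4 : ‖X‖ ≤ ‖X‖ * (1 + ‖y‖ ^ 2) := le_mul_of_one_le_right (norm_nonneg _) (by nlinarith)
  linarith

lemma gaussianIntegrable_one_add_gradient_sq (hw : IsSelfSimilarSolution p w) (hp : 1 < p)
    (hM : ∀ y, |w y| ≤ M) : GaussianIntegrable (fun y => 1 + ‖gradient w y‖ ^ 2) := by
  intro c hc
  refine ((GaussianIntegrable.one c hc).add
    (gaussianIntegrable_gradient_sq hw hp hM c hc)).congr (.of_forall fun y => ?_)
  simp only [Pi.add_apply]
  ring

lemma gaussianIntegrable_abs_rpow (hw : IsSelfSimilarSolution p w) (hp : 1 < p)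
    (hM : ∀ y, |w y| ≤ M) : GaussianIntegrable (fun y => |w y| ^ (p + 1)) := by
  refine GaussianIntegrable.one.mono (C := M ^ (p + 1)) (contDiff_abs_rpow hw.1 hp).continuous
    fun y => ?_
  rw [abs_of_nonneg (by positivity), mul_one]
  gcongr
  exact hM y

lemma gaussianIntegrable_sq (hw : IsSelfSimilarSolution p w)
    (hM : ∀ y, |w y| ≤ M) : GaussianIntegrable (fun y => w y ^ 2) := by
  refine GaussianIntegrable.one.mono (C := M ^ 2) (hw.1.continuous.pow 2) fun y => ?_
  rw [abs_pow, mul_one]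
  gcongr
  exact hM y

lemma abs_dissipation_le {u : ℝ} (hM : ∀ y, |w y| ≤ M)
    (hu : ∀ y, ‖driftField X T s y‖ ≤ u * (1 + ‖y‖ ^ 2)) (y : EuclideanSpace ℝ (Fin n)) :
    |dissipation p w X T s y| ≤ u * (1 + ‖y‖ ^ 2) * ‖gradient w y‖
      + |2 / (p - 1) * (T * s / (1 + T * s ^ 2))| * M := by
  refine (abs_add_le _ _).trans (add_le_add ((abs_real_inner_le_norm _ _).trans ?_) ?_)
  · gcongr; exact hu y
  · rw [abs_mul]; gcongr; exact hM y

lemma gaussianIntegrable_dissipation_sq (hw : IsSelfSimilarSolution p w) (hp : 1 < p)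
    (hM : ∀ y, |w y| ≤ M) : GaussianIntegrable (fun y => dissipation p w X T s y ^ 2) := by
  obtain ⟨u, hu0, hu⟩ := exists_norm_driftField_le X T s
  have hgc := (contDiff_gradient hw.1).continuous
  set c := |2 / (p - 1) * (T * s / (1 + T * s ^ 2))| with hc
  -- D is bounded by a quadratic weight times |∇w| plus a constant, so its square costs two factors
  -- 1 + |y|².
  refine (((gaussianIntegrable_one_add_gradient_sq hw hp hM).one_add_sq_mul
    (by fun_prop)).one_add_sq_mul (by fun_prop)).mono (C := 2 * u ^ 2 + 2 * (c * M) ^ 2)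
    ((contDiff_dissipation hw.1).continuous.pow 2) fun y => ?_
  have hD := abs_dissipation_le (p := p) hM hu y
  rw [← hc] at hD
  rw [abs_pow]
  set g := ‖gradient w y‖
  set Y := 1 + ‖y‖ ^ 2 with hY
  have hY1 : 1 ≤ Y := by rw [hY]; nlinarith [sq_nonneg ‖y‖]
  have h1 : |dissipation p w X T s y| ^ 2 ≤ (u * Y * g + c * M) ^ 2 := by gcongr
  have h2 : 1 ≤ Y * (Y * (1 + g ^ 2)) :=
    one_le_mul_of_one_le_of_one_le hY1
      (one_le_mul_of_one_le_of_one_le hY1 (by nlinarith [sq_nonneg g]))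
  have h3 : (c * M) ^ 2 ≤ (c * M) ^ 2 * (Y * (Y * (1 + g ^ 2))) :=
    le_mul_of_one_le_right (sq_nonneg _) h2
  have h4 : 0 ≤ u ^ 2 * Y ^ 2 := by positivity
  nlinarith [sq_nonneg (u * Y * g - c * M)]

/-- The flux is at most quadratic in ∇w, and U enters linearly, so one quadratic weight suffices. -/
lemma gaussianIntegrable_norm_energyFlux (hw : IsSelfSimilarSolution p w) (hp : 1 < p)
    (hM : ∀ y, |w y| ≤ M) : GaussianIntegrable (fun y => ‖energyFlux p w X T s y‖) := by
  obtain ⟨u, hu0, hu⟩ := exists_norm_driftField_le X T s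
  have hgc := (contDiff_gradient hw.1).continuous
  have hM0 : 0 ≤ M := (abs_nonneg _).trans (hM 0)
  set c := |2 / (p - 1) * (T * s / (1 + T * s ^ 2))| with hc
  set d := |1 / (2 * (p - 1)) * (s * (T * s / (1 + T * s ^ 2)) - 1)| with hd
  set B := 1 / (p + 1) * M ^ (p + 1) + d * M ^ 2 with hB
  have hp1 : 0 ≤ 1 / (p + 1) := one_div_nonneg.2 (by linarith)
  have hB0 : 0 ≤ B := by positivity
  refine ((gaussianIntegrable_one_add_gradient_sq hw hp hM).one_add_sq_mul
    (by fun_prop)).mono (C := u + c * M + (1 / 2 + B) * u)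
    (contDiff_energyFlux hw.1 hp).continuous.norm fun y => ?_
  have hD := abs_dissipation_le (p := p) hM hu y
  rw [← hc] at hD
  have hE : |driftCoefficient p w T s y| ≤ 1 / 2 * ‖gradient w y‖ ^ 2 + B := by
    rw [hB, ← add_assoc]
    refine (abs_add_le _ _).trans (add_le_add ((abs_add_le _ _).trans (add_le_add ?_ ?_)) ?_)
    · rw [abs_mul, abs_neg, abs_of_pos (by norm_num : (0 : ℝ) < 1 / 2), abs_of_nonneg (by positivity)]
    · rw [abs_mul, abs_of_nonneg hp1, abs_of_nonneg (by positivity)]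
      gcongr
      exact hM y
    · rw [abs_mul, abs_pow]
      gcongr
      exact hM y
  rw [abs_norm]
  refine (norm_add_le _ _).trans ?_
  rw [norm_smul, norm_smul, Real.norm_eq_abs, Real.norm_eq_abs]
  have hU := hu y
  set g := ‖gradient w y‖ with hg
  have hg0 : 0 ≤ g := norm_nonneg _
  set Y := 1 + ‖y‖ ^ 2 with hY
  have hY1 : 1 ≤ Y := by rw [hY]; nlinarith [sq_nonneg ‖y‖]
  have hY0 : 0 ≤ Y := by linarith
  have hcM : 0 ≤ c * M := by positivity
  have h1 : |dissipation p w X T s y| * g ≤ (u * Y * g + c * M) * g := by gcongr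
  have h2 : |driftCoefficient p w T s y| * ‖driftField X T s y‖
      ≤ (1 / 2 * g ^ 2 + B) * (u * Y) := by gcongr
  have h3 : g ≤ 1 + g ^ 2 := by nlinarith [sq_nonneg (g - 1)]
  have h4 : g ≤ Y * (1 + g ^ 2) := h3.trans (le_mul_of_one_le_left (by positivity) hY1)
  have h5 : (u * Y * g + c * M) * g ≤ (u + c * M) * (Y * (1 + g ^ 2)) := by
    have := mul_le_mul_of_nonneg_left h4 hcM
    have : 0 ≤ u * Y := by positivity
    nlinarith
  have h6 : (1 / 2 * g ^ 2 + B) * (u * Y) ≤ (1 / 2 + B) * u * (Y * (1 + g ^ 2)) := by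
    have h7 : 1 / 2 * g ^ 2 + B ≤ (1 / 2 + B) * (1 + g ^ 2) := by
      nlinarith [mul_nonneg hB0 (sq_nonneg g)]
    calc _ ≤ (1 / 2 + B) * (1 + g ^ 2) * (u * Y) := by gcongr
      _ = _ := by ring
  linarith

/-- The dissipation identity, integrated against the moving kernel. -/
lemma integral_curveKernel_identity (hw : IsSelfSimilarSolution p w) (hp : 1 < p)
    (hM : ∀ y, |w y| ≤ M) (hT : -1 < T) (hs : s ∈ Set.Ioo (0 : ℝ) 1) :
    1 / 2 * (∫ y, ‖gradient w y‖ ^ 2 * (curveKernel X T s y * curveKernelRate X T s y))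
        + (p + 1) / (p - 1) * (T * s / (1 + T * s ^ 2)) *
            (∫ y, ‖gradient w y‖ ^ 2 * curveKernel X T s y)
        - 1 / (p + 1) * (∫ y, |w y| ^ (p + 1) * (curveKernel X T s y * curveKernelRate X T s y))
        - 2 / (p - 1) * (T * s / (1 + T * s ^ 2)) * (∫ y, |w y| ^ (p + 1) * curveKernel X T s y)
        + 1 / (2 * (p - 1) * (1 + T * s ^ 2)) *
            (∫ y, w y ^ 2 * (curveKernel X T s y * curveKernelRate X T s y))
        + 2 / (p - 1) ^ 2 * (T * s / (1 + T * s ^ 2) ^ 2) * (∫ y, w y ^ 2 * curveKernel X T s y)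
        + s / 2 * (∫ y, dissipation p w X T s y ^ 2 * curveKernel X T s y) = 0 := by
  have hs' := Set.Ioo_subset_Icc_self hs
  have hτ := one_add_mul_sq_pos hT hs'
  have g1 := gaussianIntegrable_gradient_sq hw hp hM
  have g2 := gaussianIntegrable_abs_rpow hw hp hM
  have g3 := gaussianIntegrable_sq hw hM
  have c1 := (contDiff_gradient hw.1).continuous.norm.pow 2
  have c2 := (contDiff_abs_rpow hw.1 hp).continuous
  have c3 := hw.1.continuous.pow 2
  have i1 := (hasDerivAt_integral_mul_curveKernel (X := X) g1 c1 hT hs).1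
  have i2 := (hasDerivAt_integral_mul_curveKernel (X := X) g2 c2 hT hs).1
  have i3 := (hasDerivAt_integral_mul_curveKernel (X := X) g3 c3 hT hs).1
  have j1 := g1.mul_curveKernel c1 hT hs' (X := X)
  have j2 := g2.mul_curveKernel c2 hT hs' (X := X)
  have j3 := g3.mul_curveKernel c3 hT hs' (X := X)
  have j4 := (gaussianIntegrable_dissipation_sq (X := X) (T := T) (s := s) hw hp hM).mul_curveKernel
    ((contDiff_dissipation hw.1).continuous.pow 2) hT hs' (X := X)
  have hWC : ContDiff ℝ 1 fun y => curveKernel X T s y • energyFlux p w X T s y :=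
    contDiff_curveKernel.smul (contDiff_energyFlux hw.1 hp)
  have hWi : Integrable fun y => curveKernel X T s y • energyFlux p w X T s y := by
    refine ((gaussianIntegrable_norm_energyFlux (X := X) (T := T) (s := s) hw hp hM).mul_curveKernel
      (contDiff_energyFlux hw.1 hp).continuous.norm hT hs' (X := X)).mono'
      hWC.continuous.aestronglyMeasurable (.of_forall fun y => ?_)
    rw [norm_smul, Real.norm_of_nonneg (curveKernel_pos hT hs' y).le, mul_comm]
  have hdiv := funext (divergence_curveKernel_smul_energyFlux (X := X) hw hp hτ)
  have k1 := i1.const_mul (1 / 2)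
  have k2 := k1.add (j1.const_mul ((p + 1) / (p - 1) * (T * s / (1 + T * s ^ 2))))
  have k3 := k2.sub (i2.const_mul (1 / (p + 1)))
  have k4 := k3.sub (j2.const_mul (2 / (p - 1) * (T * s / (1 + T * s ^ 2))))
  have k5 := k4.add (i3.const_mul (1 / (2 * (p - 1) * (1 + T * s ^ 2))))
  have k6 := k5.add (j3.const_mul (2 / (p - 1) ^ 2 * (T * s / (1 + T * s ^ 2) ^ 2)))
  have k7 := k6.add (j4.const_mul (s / 2))
  have h0 := integral_divergence_eq_zero hWC hWi (by rw [hdiv]; exact k7)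
  rw [hdiv] at h0
  simp only [← integral_const_mul]
  rw [← integral_add' k1 (j1.const_mul _), ← integral_sub' k2 (i2.const_mul _),
    ← integral_sub' k3 (j2.const_mul _), ← integral_add' k4 (i3.const_mul _),
    ← integral_add' k5 (j3.const_mul _), ← integral_add' k6 (j4.const_mul _)]
  exact h0

lemma FFunctional_curve (p : ℝ) (w : EuclideanSpace ℝ (Fin n) → ℝ)
    (X : EuclideanSpace ℝ (Fin n)) (T s : ℝ) :
    FFunctional p w (s • X) (-(1 + T * s ^ 2)) =
      1 / 2 * (1 + T * s ^ 2) ^ ((p + 1) / (p - 1)) * (∫ y, ‖gradient w y‖ ^ 2 * curveKernel X T s y)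
      - 1 / (p + 1) * (1 + T * s ^ 2) ^ ((p + 1) / (p - 1)) *
        (∫ y, |w y| ^ (p + 1) * curveKernel X T s y)
      + 1 / (2 * (p - 1)) * (1 + T * s ^ 2) ^ (2 / (p - 1)) *
        (∫ y, w y ^ 2 * curveKernel X T s y) := by
  simp only [FFunctional, neg_neg, curveKernel]

/-- Along the curve `s ↦ (sX, -(1 + T s²))` the functional dissipates. -/
lemma hasDerivAt_FFunctional_curve (hw : IsSelfSimilarSolution p w) (hp : 1 < p)
    (hM : ∀ y, |w y| ≤ M) (hT : -1 < T) (hs : s ∈ Set.Ioo (0 : ℝ) 1) :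
    HasDerivAt (fun s => FFunctional p w (s • X) (-(1 + T * s ^ 2)))
      (-((1 + T * s ^ 2) ^ ((p + 1) / (p - 1)) * (s / 2) *
        ∫ y, dissipation p w X T s y ^ 2 * curveKernel X T s y)) s := by
  have hτ := one_add_mul_sq_pos hT (Set.Ioo_subset_Icc_self hs)
  have d1 := (hasDerivAt_integral_mul_curveKernel (X := X)
    (gaussianIntegrable_gradient_sq hw hp hM)
    ((contDiff_gradient hw.1).continuous.norm.pow 2) hT hs).2
  have d2 := (hasDerivAt_integral_mul_curveKernel (X := X)
    (gaussianIntegrable_abs_rpow hw hp hM) (contDiff_abs_rpow hw.1 hp).continuous hT hs).2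
  have d3 := (hasDerivAt_integral_mul_curveKernel (X := X)
    (gaussianIntegrable_sq hw hM) (hw.1.continuous.pow 2) hT hs).2
  have hid := integral_curveKernel_identity (X := X) hw hp hM hT hs
  have hτd : HasDerivAt (fun s : ℝ => 1 + T * s ^ 2) (2 * T * s) s := by
    refine (((hasDerivAt_pow 2 s).const_mul T).const_add 1).congr_deriv ?_
    simp; ring
  have e1 := hτd.rpow_const (p := (p + 1) / (p - 1)) (Or.inl hτ.ne')
  have e2 := hτd.rpow_const (p := 2 / (p - 1)) (Or.inl hτ.ne')
  simp only [FFunctional_curve]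
  refine ((((e1.const_mul (1 / 2)).fun_mul d1).fun_sub ((e1.const_mul (1 / (p + 1))).fun_mul
    d2)).fun_add ((e2.const_mul (1 / (2 * (p - 1)))).fun_mul d3)).congr_deriv ?_
  have hp1 : p - 1 ≠ 0 := by linarith
  have hp2 : p + 1 ≠ 0 := by linarith
  -- The two powers of τ in F differ by exactly one, so the derivative is A τ times the integrated
  -- identity, up to the dissipation term.
  have hexp : (p + 1) / (p - 1) = 2 / (p - 1) + 1 := by field_simp; ring
  have hpow : (1 + T * s ^ 2) ^ ((p + 1) / (p - 1)) =
      (1 + T * s ^ 2) ^ (2 / (p - 1)) * (1 + T * s ^ 2) := by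
    rw [hexp, Real.rpow_add_one hτ.ne']
  rw [Real.rpow_sub_one hτ.ne', Real.rpow_sub_one hτ.ne', hpow]
  generalize (1 + T * s ^ 2) ^ (2 / (p - 1)) = A
  generalize (∫ y, ‖gradient w y‖ ^ 2 * curveKernel X T s y) = I1 at *
  generalize (∫ y, |w y| ^ (p + 1) * curveKernel X T s y) = I2 at *
  generalize (∫ y, w y ^ 2 * curveKernel X T s y) = I3 at *
  generalize (∫ y, ‖gradient w y‖ ^ 2 * (curveKernel X T s y * curveKernelRate X T s y)) = J1 at *
  generalize (∫ y, |w y| ^ (p + 1) * (curveKernel X T s y * curveKernelRate X T s y)) = J2 at *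
  generalize (∫ y, w y ^ 2 * (curveKernel X T s y * curveKernelRate X T s y)) = J3 at *
  generalize (∫ y, dissipation p w X T s y ^ 2 * curveKernel X T s y) = D at *
  have hτ' := hτ.ne'
  rw [← sub_eq_zero]
  have h0 := congrArg (fun x => A * (1 + T * s ^ 2) * x) hid
  simp only [mul_zero] at h0
  rw [← h0]
  field_simp
  ring

theorem antitoneOn_FFunctional_curve (hw : IsSelfSimilarSolution p w) (hp : 1 < p)
    (hM : ∀ y, |w y| ≤ M) (hT : -1 < T) (X : EuclideanSpace ℝ (Fin n)) :
    AntitoneOn (fun s : ℝ => FFunctional p w (s • X) (-(1 + T * s ^ 2))) (Set.Icc 0 1) := by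
  refine antitoneOn_of_deriv_nonpos (convex_Icc 0 1) ?_ ?_ ?_
  · simp only [FFunctional_curve]
    have c1 := continuousOn_integral_mul_curveKernel (X := X)
      (gaussianIntegrable_gradient_sq hw hp hM)
      ((contDiff_gradient hw.1).continuous.norm.pow 2) hT
    have c2 := continuousOn_integral_mul_curveKernel (X := X)
      (gaussianIntegrable_abs_rpow hw hp hM) (contDiff_abs_rpow hw.1 hp).continuous hT
    have c3 := continuousOn_integral_mul_curveKernel (X := X)
      (gaussianIntegrable_sq hw hM) (hw.1.continuous.pow 2) hT
    have cτ (q : ℝ) : ContinuousOn (fun s : ℝ => (1 + T * s ^ 2) ^ q) (Set.Icc 0 1) :=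
      (by fun_prop : Continuous fun s : ℝ => 1 + T * s ^ 2).continuousOn.rpow_const
        fun s hs => Or.inl (one_add_mul_sq_pos hT hs).ne'
    exact (((continuousOn_const.mul (cτ _)).mul c1).sub
      ((continuousOn_const.mul (cτ _)).mul c2)).add ((continuousOn_const.mul (cτ _)).mul c3)
  · rw [interior_Icc]
    exact fun s hs => (hasDerivAt_FFunctional_curve hw hp hM hT
      hs).differentiableAt.differentiableWithinAt
  · rw [interior_Icc]
    intro s hs
    rw [(hasDerivAt_FFunctional_curve hw hp hM hT hs).deriv, neg_nonpos]
    have hs' := Set.Ioo_subset_Icc_self hs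
    have := (one_add_mul_sq_pos hT hs').le
    have := hs'.1
    have : 0 ≤ ∫ y, dissipation p w X T s y ^ 2 * curveKernel X T s y :=
      integral_nonneg fun y => mul_nonneg (sq_nonneg _) (curveKernel_pos hT hs' y).le
    positivity

/-! ### Comparison with the base point and the entropy -/

theorem FFunctional_le (hw : IsSelfSimilarSolution p w) (hp : 1 < p) (hM : ∀ y, |w y| ≤ M)
    (x₀ : EuclideanSpace ℝ (Fin n)) {t₀ : ℝ} (ht : t₀ < 0) :
    FFunctional p w x₀ t₀ ≤ FFunctional p w 0 (-1) := by
  -- With this T the curve runs from (0,-1) at s = 0 to (x₀,t₀) at s = 1, and t₀ < 0 is the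
  -- condition -1 < T.
  have h := antitoneOn_FFunctional_curve (T := -t₀ - 1) hw hp hM (by linarith) x₀
    (Set.left_mem_Icc.2 zero_le_one) (Set.right_mem_Icc.2 zero_le_one) zero_le_one
  simpa using h

theorem fIntegrable (hw : IsSelfSimilarSolution p w) (hp : 1 < p) (hM : ∀ y, |w y| ≤ M)
    (x₀ : EuclideanSpace ℝ (Fin n)) {t₀ : ℝ} (ht : t₀ < 0) : FIntegrable p w x₀ t₀ := by
  have hT : -1 < -t₀ - 1 := by linarith
  have hs : (1 : ℝ) ∈ Set.Icc (0 : ℝ) 1 := Set.right_mem_Icc.2 zero_le_one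
  -- Every admissible heat kernel is the endpoint s = 1 of such a curve, so the bounds along curves
  -- apply to it.
  have hK : curveKernel x₀ (-t₀ - 1) 1 = fun y => heatKernel (y - x₀) t₀ := by
    ext y; simp [curveKernel]
  have h1 := (gaussianIntegrable_gradient_sq hw hp hM).mul_curveKernel
    ((contDiff_gradient hw.1).continuous.norm.pow 2) hT hs (X := x₀)
  have h2 := (gaussianIntegrable_abs_rpow hw hp hM).mul_curveKernel
    (contDiff_abs_rpow hw.1 hp).continuous hT hs (X := x₀)
  have h3 := (gaussianIntegrable_sq hw hM).mul_curveKernel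
    (hw.1.continuous.pow 2) hT hs (X := x₀)
  rw [hK] at h1 h2 h3
  exact ⟨h1, h2, h3⟩

lemma FFunctional_zero_neg_one (p : ℝ) (w : EuclideanSpace ℝ (Fin n) → ℝ) :
    FFunctional p w 0 (-1) = weightedEnergy p w := by
  have hK (y : EuclideanSpace ℝ (Fin n)) : heatKernel (y - 0) (-1) = gaussianWeight y := by
    simp only [heatKernel, gaussianWeight, sub_zero]
    congr 2 <;> ring
  simp only [FFunctional, weightedEnergy, hK, neg_neg, Real.one_rpow, mul_one]
  ring

lemma entropy_eq_of_forall_le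
    (h : ∀ (x₀ : EuclideanSpace ℝ (Fin n)) (t₀ : ℝ), t₀ < 0 →
      FFunctional p w x₀ t₀ ≤ FFunctional p w 0 (-1)) :
    entropy p w = ((FFunctional p w 0 (-1) : ℝ) : EReal) := by
  refine le_antisymm (iSup_le fun x₀ => iSup_le fun t₀ => iSup_le fun ht =>
    EReal.coe_le_coe_iff.2 (h x₀ t₀ ht)) ?_
  exact le_iSup_of_le 0 (le_iSup_of_le (-1) (le_iSup_of_le (by norm_num) le_rfl))

end Monotonicity

end SupercriticalFujita

end

theorem corollary7p2 (n : ℕ) (hn : 3 ≤ n) (p : ℝ) (hp : ((n : ℝ) + 2) / ((n : ℝ) - 2) < p)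
    (w : EuclideanSpace ℝ (Fin n) → ℝ)
    (hw : SupercriticalFujita.IsSelfSimilarSolution p w)
    (hbdd : ∃ M : ℝ, ∀ y, |w y| ≤ M) :
    (∀ (x₀ : EuclideanSpace ℝ (Fin n)) (t₀ : ℝ), t₀ < 0 →
        SupercriticalFujita.FIntegrable p w x₀ t₀) ∧
      (∀ (x₀ : EuclideanSpace ℝ (Fin n)) (t₀ : ℝ), t₀ < 0 →
        SupercriticalFujita.FFunctional p w x₀ t₀ ≤ SupercriticalFujita.FFunctional p w 0 (-1)) ∧
      SupercriticalFujita.entropy p w =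
        ((SupercriticalFujita.FFunctional p w 0 (-1) : ℝ) : EReal) ∧
      SupercriticalFujita.entropy p w =
        ((SupercriticalFujita.weightedEnergy p w : ℝ) : EReal) := by
  obtain ⟨M, hM⟩ := hbdd
  have hp1 : 1 < p := by
    have h3 : (3 : ℝ) ≤ n := by exact_mod_cast hn
    refine lt_trans ?_ hp
    rw [one_lt_div (by linarith)]
    linarith
  have hle := fun (x₀ : EuclideanSpace ℝ (Fin n)) (t₀ : ℝ) (ht : t₀ < 0) =>
    SupercriticalFujita.FFunctional_le hw hp1 hM x₀ ht
  have hent := SupercriticalFujita.entropy_eq_of_forall_le hle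
  exact ⟨fun x₀ t₀ ht => SupercriticalFujita.fIntegrable hw hp1 hM x₀ ht, hle, hent,
    hent.trans (by rw [SupercriticalFujita.FFunctional_zero_neg_one])⟩
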